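/- All graphs are simple, undirected and locally finite. For a graph $G$ let $P_G$ denote the transition matrix of the lazy simple random walk on $G$: $P_G(x,y)=\frac{1}{2\deg_G(x)}$ if $\{x,y\}$ is an edge, $P_G(x,x)=\frac12$, and all other entries are $0$; at an isolated vertex $x$ the walk does not move, i.e. $P_G(x,x)=1$, so that $P_G$ is always stochastic. If $G$ is finite with $N$ vertices, let $\lambda_1(G)\ge\dots\ge\lambda_N(G)$ be the eigenvalues of $P_G$, counted with multiplicity. Let $\mathscr G_\bullet$ be the set of connected rooted graphs $(G,o)$ up to root-preserving isomorphism, with the distance $d((G,o),(G',o'))=\frac1{1+r}$, where $r$ is the supremum of the integers $t\ge 0$ for which the balls of radius $t$ around $o$ in $G$ and around $o'$ in $G'$ are isomorphic as rooted graphs, and with its Borel $\sigma$-algebra. The local profile of a non-empty finite graph $G=(V,E)$ is the probability measure $\mathcal L_G=\frac1{|V|}\sum_{x\in V}\delta_{(G,x)}$ on $\mathscr G_\bullet$, where $(G,x)$ stands for the connected component of $x$ in $G$, rooted at $x$. A probability measure $\mathcal L$ on $\mathscr G_\bullet$ is the local weak limit of finite graphs $G_n$ if $\mathcal L_{G_n}\to\mathcal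 L$ weakly as $n\to\infty$. The spectral radius of $(G,o)\in\mathscr G_\bullet$ is $\rho(G)=\lim_{t\to\infty}P_G^t(o,o)^{1/t}$ (the limit exists and does not depend on $o$). **Theorem 3.2 (Zero-entropy implies poor spectral expansion).** Let $G_n=(V_n,E_n)$, $n\ge1$, be non-empty finite graphs having a local weak limit $\mathcal L$, and suppose that $\mathcal L(\rho(G)=1)=1$. Then, for every real $\rho<1$, $$\liminf_{n\to\infty}\ \frac{1}{|V_n|}\,\mathrm{card}\{i:\lambda_i(G_n)>\rho\}\;>\;0 .$$ -/

import Mathlib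

open Filter Topology MeasureTheory

universe u v

/-! ### The lazy simple random walk on a graph -/

/-- The transition matrix of the lazy simple random walk on a locally finite simple graph: stay put
with probability `1/2`, otherwise jump to a uniformly chosen neighbour. A walk started at an
isolated vertex never moves, so that every row of the matrix sums to `1`. -/
noncomputable def lazyWalk {V : Type u} (G : SimpleGraph V) : Matrix V V ℝ :=
  open Classical in
  Matrix.of fun x y =>
    if x = y then (if (G.neighborSet x).Nonempty then 1 / 2 else 1)
    else if G.Adj x y then 1 / (2 * ((G.neighborSet x).ncard : ℝ))
    else 0

/-- The `t`-step transition probabilities of the lazy simple random walk, that is the entries of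
the `t`-th power of `lazyWalk G` (the vertex set may be infinite; in a locally finite graph the sum
below has only finitely many non-zero terms). -/
noncomputable def stepProb {V : Type u} (G : SimpleGraph V) : ℕ → V → V → ℝ
  | 0 => fun x y => open Classical in if x = y then 1 else 0
  | t + 1 => fun x y => ∑ᶠ z, lazyWalk G x z * stepProb G t z y

/-- The number of eigenvalues of the transition matrix of a finite graph, counted with
multiplicity, that are larger than `r`. The matrix is diagonalizable over `ℝ`, so the multiset of
roots of its characteristic polynomial is exactly the multiset of its eigenvalues. -/
noncomputable def numEigenvaluesGT {V : Type u} [Fintype V] (G : SimpleGraph V) (r : ℝ) : ℕ :=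
  open Classical in
  ((lazyWalk G).charpoly.roots.filter fun l => r < l).card

/-! ### Rooted graphs and their isomorphism classes -/

/-- A connected, locally finite, rooted simple graph (such a graph is automatically countable). -/
structure RootedGraph : Type (u + 1) where
  /-- the vertices -/
  V : Type u
  /-- the graph -/
  G : SimpleGraph V
  /-- the root -/
  root : V
  connected : G.Connected
  locallyFinite : ∀ x, (G.neighborSet x).Finite

namespace RootedGraph

/-- The vertices at distance at most `t` from the root. -/
def ballSet (A : RootedGraph.{u}) (t : ℕ) : Set A.V := {x | A.G.dist A.root x ≤ t}

theorem root_mem_ballSet (A : RootedGraph.{u}) (t : ℕ) : A.root ∈ A.ballSet t := by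
  simp [ballSet]

/-- The graph induced on the ball of radius `t` around the root. -/
abbrev ballGraph (A : RootedGraph.{u}) (t : ℕ) : SimpleGraph (A.ballSet t) :=
  A.G.induce (A.ballSet t)

/-- The root of the ball of radius `t`. -/
def ballRoot (A : RootedGraph.{u}) (t : ℕ) : A.ballSet t := ⟨A.root, A.root_mem_ballSet t⟩

/-- Isomorphism of rooted graphs. -/
def Iso (A B : RootedGraph.{u}) : Prop := ∃ f : A.G ≃g B.G, f A.root = B.root

/-- The balls of radius `t` around the roots are isomorphic as rooted graphs. -/
def BallIso (A B : RootedGraph.{u}) (t : ℕ) : Prop :=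
  ∃ f : A.ballGraph t ≃g B.ballGraph t, f (A.ballRoot t) = B.ballRoot t

instance setoid : Setoid RootedGraph.{u} where
  r := Iso
  iseqv :=
    { refl := fun A => ⟨SimpleGraph.Iso.refl, rfl⟩
      symm := by
        rintro A B ⟨f, hf⟩
        exact ⟨f.symm, by rw [← hf]; simp⟩
      trans := by
        rintro A B C ⟨f, hf⟩ ⟨g, hg⟩
        exact ⟨f.trans g, by simp [hf, hg]⟩ }

theorem BallIso.refl (A : RootedGraph.{u}) (t : ℕ) : BallIso A A t :=
  ⟨SimpleGraph.Iso.refl, rfl⟩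

theorem BallIso.symm {A B : RootedGraph.{u}} {t : ℕ} (h : BallIso A B t) : BallIso B A t := by
  obtain ⟨f, hf⟩ := h
  exact ⟨f.symm, by rw [← hf]; simp⟩

theorem BallIso.trans {A B C : RootedGraph.{u}} {t : ℕ} (h : BallIso A B t)
    (h' : BallIso B C t) : BallIso A C t := by
  obtain ⟨f, hf⟩ := h
  obtain ⟨g, hg⟩ := h'
  exact ⟨f.trans g, by simp [hf, hg]⟩

/-- A graph homomorphism does not increase distances between connected vertices. -/
theorem dist_hom_le {V : Type u} {W : Type v} {G : SimpleGraph V} {H : SimpleGraph W}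
    (f : G →g H) {x y : V} (h : G.Reachable x y) : H.dist (f x) (f y) ≤ G.dist x y := by
  obtain ⟨p, hp⟩ := h.exists_walk_length_eq_dist
  rw [← hp, ← SimpleGraph.Walk.length_map f p]
  exact SimpleGraph.dist_le _

theorem dist_iso {V : Type u} {W : Type v} {G : SimpleGraph V} {H : SimpleGraph W}
    (f : G ≃g H) (hG : G.Connected) (x y : V) : H.dist (f x) (f y) = G.dist x y := by
  refine le_antisymm (dist_hom_le f.toHom (hG x y)) ?_
  have hH : H.Reachable (f x) (f y) := (hG x y).map f.toHom
  simpa using dist_hom_le f.symm.toHom hH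

theorem Iso.ballIso {A B : RootedGraph.{u}} (h : Iso A B) (t : ℕ) : BallIso A B t := by
  obtain ⟨f, hf⟩ := h
  have key : ∀ x, x ∈ A.ballSet t ↔ f x ∈ B.ballSet t := fun x => by
    change A.G.dist A.root x ≤ t ↔ B.G.dist B.root (f x) ≤ t
    rw [← hf, dist_iso f A.connected]
  refine ⟨⟨f.toEquiv.subtypeEquiv key, ?_⟩, ?_⟩
  · intro a b
    exact f.map_adj_iff
  · apply Subtype.ext
    exact hf

/-- Vertices of a ball are joined to the root by a path of minimal length inside the ball. -/
theorem exists_walk_ballGraph (A : RootedGraph.{u}) (t : ℕ) (x : A.ballSet t) :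
    ∃ p : (A.ballGraph t).Walk (A.ballRoot t) x, p.length = A.G.dist A.root x := by
  classical
  obtain ⟨p, hp⟩ := (A.connected A.root x.1).exists_walk_length_eq_dist
  have hs : ∀ y ∈ p.support, y ∈ A.ballSet t := by
    intro y hy
    have h1 : A.G.dist A.root y ≤ (p.takeUntil y hy).length := SimpleGraph.dist_le _
    have h2 := p.length_takeUntil_le_length hy
    have h3 : A.G.dist A.root x ≤ t := x.2
    change A.G.dist A.root y ≤ t
    omega
  refine ⟨p.induce (A.ballSet t) hs, ?_⟩
  rw [← hp]
  exact (SimpleGraph.Walk.length_map (SimpleGraph.Embedding.induce (A.ballSet t)).toHom _).symm.trans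
    (congrArg SimpleGraph.Walk.length (SimpleGraph.Walk.map_induce p hs))

theorem dist_ballGraph (A : RootedGraph.{u}) (t : ℕ) (x : A.ballSet t) :
    (A.ballGraph t).dist (A.ballRoot t) x = A.G.dist A.root x := by
  obtain ⟨p, hp⟩ := A.exists_walk_ballGraph t x
  refine le_antisymm (hp ▸ SimpleGraph.dist_le p) ?_
  exact dist_hom_le (SimpleGraph.Embedding.induce (A.ballSet t)).toHom p.reachable

theorem BallIso.mono {A B : RootedGraph.{u}} {s t : ℕ} (hst : s ≤ t) (h : BallIso A B t) :
    BallIso A B s := by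
  obtain ⟨f, hf⟩ := h
  have hconn : (A.ballGraph t).Connected := by
    have : Nonempty (A.ballSet t) := ⟨A.ballRoot t⟩
    refine ⟨fun x y => ?_⟩
    obtain ⟨p, -⟩ := A.exists_walk_ballGraph t x
    obtain ⟨q, -⟩ := A.exists_walk_ballGraph t y
    exact p.reachable.symm.trans q.reachable
  have hd : ∀ x : A.ballSet t, B.G.dist B.root (f x) = A.G.dist A.root x := fun x => by
    rw [← dist_ballGraph B t (f x), ← hf, dist_iso f hconn, dist_ballGraph]
  have hAs : ∀ x ∈ A.ballSet s, x ∈ A.ballSet t := fun x (hx : _ ≤ s) => hx.trans hst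
  have hBs : ∀ x ∈ B.ballSet s, x ∈ B.ballSet t := fun x (hx : _ ≤ s) => hx.trans hst
  have hd' : ∀ y : B.ballSet t, A.G.dist A.root (f.symm y) = B.G.dist B.root y := fun y => by
    rw [← hd (f.symm y)]; simp
  refine ⟨⟨⟨fun x => ⟨(f ⟨x.1, hAs _ x.2⟩).1, ?_⟩, fun y => ⟨(f.symm ⟨y.1, hBs _ y.2⟩).1, ?_⟩,
    fun x => ?_, fun y => ?_⟩, ?_⟩, ?_⟩
  · have := hd ⟨x.1, hAs _ x.2⟩
    exact this.le.trans x.2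
  · have := hd' ⟨y.1, hBs _ y.2⟩
    exact this.le.trans y.2
  · simp
  · simp
  · intro a b
    have := f.map_rel_iff (a := ⟨a.1, hAs _ a.2⟩) (b := ⟨b.1, hAs _ b.2⟩)
    simpa using this
  · apply Subtype.ext
    exact congrArg (fun z : B.ballSet t => (z : B.V)) hf

/-- The supremum of the radii up to which the balls around the two roots are isomorphic. -/
noncomputable def agreeRadius (A B : RootedGraph.{u}) : ℕ∞ :=
  ⨆ (t : ℕ) (_ : BallIso A B t), (t : ℕ∞)

theorem agreeRadius_comm (A B : RootedGraph.{u}) : agreeRadius A B = agreeRadius B A := by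
  unfold agreeRadius
  congr 1; funext t
  rw [show BallIso A B t = BallIso B A t from propext ⟨BallIso.symm, BallIso.symm⟩]

theorem agreeRadius_self (A : RootedGraph.{u}) : agreeRadius A A = ⊤ := by
  refine ENat.eq_top_iff_forall_ge.2 fun m => ?_
  exact le_iSup₂_of_le (f := fun (t : ℕ) (_ : BallIso A A t) => (t : ℕ∞)) m (BallIso.refl A m) le_rfl

theorem le_agreeRadius_iff (A B : RootedGraph.{u}) (t : ℕ) :
    (t : ℕ∞) ≤ agreeRadius A B ↔ t = 0 ∨ BallIso A B t := by
  constructor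
  · intro h
    rcases Nat.eq_zero_or_pos t with rfl | ht
    · exact Or.inl rfl
    · right
      have h1 : ((t - 1 : ℕ) : ℕ∞) < agreeRadius A B :=
        lt_of_lt_of_le (by exact_mod_cast Nat.sub_lt ht one_pos) h
      obtain ⟨s, hs⟩ := lt_iSup_iff.1 h1
      obtain ⟨hs1, hs2⟩ := lt_iSup_iff.1 hs
      have hs3 : t - 1 < s := by exact_mod_cast hs2
      exact hs1.mono (by omega)
  · rintro (rfl | h)
    · simp
    · exact le_iSup₂_of_le (f := fun (t : ℕ) (_ : BallIso A B t) => (t : ℕ∞)) t h le_rfl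

theorem min_le_agreeRadius (A B C : RootedGraph.{u}) :
    min (agreeRadius A B) (agreeRadius B C) ≤ agreeRadius A C := by
  refine ENat.forall_natCast_le_iff_le.1 fun t ht => ?_
  have h1 := (le_agreeRadius_iff A B t).1 (ht.trans (min_le_left _ _))
  have h2 := (le_agreeRadius_iff B C t).1 (ht.trans (min_le_right _ _))
  rw [le_agreeRadius_iff]
  rcases h1 with h1 | h1
  · exact Or.inl h1
  rcases h2 with h2 | h2
  · exact Or.inl h2
  exact Or.inr (h1.trans h2)

/-- The local distance `1 / (1 + r)`, where `r` is the largest radius up to which the balls around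
the two roots are isomorphic; it is `0` when `r` is infinite. -/
noncomputable def localDist (A B : RootedGraph.{u}) : ℝ :=
  ((1 + (agreeRadius A B : ENNReal))⁻¹).toReal

theorem localDist_le_of_le {A B C D : RootedGraph.{u}}
    (h : agreeRadius A B ≤ agreeRadius C D) : localDist C D ≤ localDist A B := by
  refine ENNReal.toReal_mono (by simp) ?_
  gcongr

theorem localDist_triangle (A B C : RootedGraph.{u}) :
    localDist A C ≤ localDist A B + localDist B C := by
  have h0 : ∀ A B : RootedGraph.{u}, 0 ≤ localDist A B := fun _ _ => ENNReal.toReal_nonneg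
  rcases min_le_iff.1 (min_le_agreeRadius A B C) with h | h
  · linarith [localDist_le_of_le h, h0 B C]
  · linarith [localDist_le_of_le h, h0 A B]

theorem agreeRadius_congr {A B A' B' : RootedGraph.{u}} (hA : Iso A A') (hB : Iso B B') :
    agreeRadius A B = agreeRadius A' B' := by
  unfold agreeRadius
  congr 1; funext t
  rw [show BallIso A B t = BallIso A' B' t from propext
    ⟨fun h => ((hA.ballIso t).symm.trans h).trans (hB.ballIso t),
      fun h => ((hA.ballIso t).trans h).trans (hB.ballIso t).symm⟩]

theorem ncard_neighborSet_iso {V : Type u} {W : Type v} {G : SimpleGraph V} {H : SimpleGraph W}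
    (f : G ≃g H) (x : V) : (H.neighborSet (f x)).ncard = (G.neighborSet x).ncard := by
  have : H.neighborSet (f x) = f '' G.neighborSet x := by
    ext y
    obtain ⟨y, rfl⟩ := f.surjective y
    rw [f.injective.mem_set_image]
    exact f.map_adj_iff
  rw [this, Set.ncard_image_of_injective _ f.injective]

theorem lazyWalk_iso {V : Type u} {W : Type v} {G : SimpleGraph V} {H : SimpleGraph W}
    (f : G ≃g H) (x y : V) : lazyWalk H (f x) (f y) = lazyWalk G x y := by
  have h : (H.neighborSet (f x)).Nonempty ↔ (G.neighborSet x).Nonempty := by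
    constructor
    · rintro ⟨y, hy⟩
      obtain ⟨y, rfl⟩ := f.surjective y
      exact ⟨y, f.map_adj_iff.1 hy⟩
    · rintro ⟨y, hy⟩
      exact ⟨f y, f.map_adj_iff.2 hy⟩
  have h1 : f x = f y ↔ x = y := f.injective.eq_iff
  have h2 : H.Adj (f x) (f y) ↔ G.Adj x y := f.map_adj_iff
  simp only [lazyWalk, Matrix.of_apply, ncard_neighborSet_iso]
  classical
  exact if_congr h1 (if_congr h rfl rfl) (if_congr h2 rfl rfl)

theorem stepProb_iso {V : Type u} {W : Type v} {G : SimpleGraph V} {H : SimpleGraph W}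
    (f : G ≃g H) (t : ℕ) (x y : V) : stepProb H t (f x) (f y) = stepProb G t x y := by
  induction t generalizing x with
  | zero =>
    have h1 : f x = f y ↔ x = y := f.injective.eq_iff
    simp only [stepProb]
    classical
    exact if_congr h1 rfl rfl
  | succ t ih =>
    simp only [stepProb]
    rw [← finsum_comp_equiv f.toEquiv]
    refine finsum_congr fun z => ?_
    exact congrArg₂ _ (lazyWalk_iso f x z) (ih z)

/-- The probability that the lazy simple random walk started at the root is back at the root at
time `t`. -/
noncomputable def returnProb (A : RootedGraph.{u}) (t : ℕ) : ℝ := stepProb A.G t A.root A.root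

theorem Iso.returnProb_eq {A B : RootedGraph.{u}} (h : Iso A B) (t : ℕ) :
    A.returnProb t = B.returnProb t := by
  obtain ⟨f, hf⟩ := h
  rw [returnProb, returnProb, ← hf, stepProb_iso]

/-- The spectral radius: the limit of the `t`-th root of the return probability at time `t`. -/
noncomputable def spectralRadius (A : RootedGraph.{u}) : ℝ :=
  limUnder atTop fun t : ℕ => (A.returnProb t) ^ (1 / (t : ℝ))

end RootedGraph

/-! ### The limit that defines the spectral radius exists -/

namespace RootedGraph

theorem lazyWalk_nonneg {V : Type u} (G : SimpleGraph V) (x y : V) : 0 ≤ lazyWalk G x y := by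
  simp only [lazyWalk, Matrix.of_apply]
  split_ifs <;> positivity

theorem lazyWalk_support {V : Type u} (G : SimpleGraph V) (x : V)
    (hx : (G.neighborSet x).Finite) :
    (Function.support fun z => lazyWalk G x z) ⊆ ((insert x hx.toFinset : Set V)) := by
  intro z hz
  by_contra h
  simp only [Set.mem_insert_iff, not_or, Set.Finite.coe_toFinset,
    SimpleGraph.mem_neighborSet] at h
  exact hz (by simp [lazyWalk, h.2, Ne.symm h.1])

theorem lazyWalk_sum {V : Type u} (G : SimpleGraph V) (x : V)
    (hx : (G.neighborSet x).Finite) : ∑ᶠ z, lazyWalk G x z = 1 := by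
  classical
  rw [finsum_eq_sum_of_support_subset (s := insert x hx.toFinset) _
    (by simpa using lazyWalk_support G x hx), Finset.sum_insert (by simp)]
  have h1 : ∑ z ∈ hx.toFinset, lazyWalk G x z
      = ∑ z ∈ hx.toFinset, 1 / (2 * ((G.neighborSet x).ncard : ℝ)) := by
    refine Finset.sum_congr rfl fun z hz => ?_
    have hz' : G.Adj x z := by simpa using hz
    simp [lazyWalk, hz', hz'.ne]
  rw [h1, Finset.sum_const, ← Set.ncard_eq_toFinset_card _ hx]
  by_cases h : (G.neighborSet x).Nonempty
  · have : ((G.neighborSet x).ncard : ℝ) ≠ 0 := by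
      exact_mod_cast ((Set.ncard_pos hx).2 h).ne'
    simp only [lazyWalk, Matrix.of_apply, if_true, h, nsmul_eq_mul]
    field_simp
    norm_num
  · simp only [lazyWalk, Matrix.of_apply, if_true, h, if_false]
    rw [Set.not_nonempty_iff_eq_empty] at h
    simp only [h, Set.ncard_empty, zero_smul, add_zero]

theorem support_finite {V : Type u} (G : SimpleGraph V) (hG : ∀ x, (G.neighborSet x).Finite)
    (x : V) (f : V → ℝ) : (Function.support fun z => lazyWalk G x z * f z).Finite := by
  refine Set.Finite.subset (Set.Finite.insert x (hG x).toFinset.finite_toSet) ?_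
  exact (Function.support_mul_subset_left _ _).trans (lazyWalk_support G x (hG x))

theorem stepProb_nonneg {V : Type u} (G : SimpleGraph V) (t : ℕ) (x y : V) :
    0 ≤ stepProb G t x y := by
  induction t generalizing x with
  | zero => simp only [stepProb]; split_ifs <;> norm_num
  | succ t ih => exact finsum_nonneg fun z => mul_nonneg (lazyWalk_nonneg G x z) (ih z)

theorem stepProb_le_one {V : Type u} (G : SimpleGraph V) (hG : ∀ x, (G.neighborSet x).Finite)
    (t : ℕ) (x y : V) : stepProb G t x y ≤ 1 := by
  induction t generalizing x with
  | zero => simp only [stepProb]; split_ifs <;> norm_num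
  | succ t ih =>
    rw [← lazyWalk_sum G x (hG x)]
    refine finsum_le_finsum' (support_finite G hG x _) ?_ fun z => ?_
    · have := support_finite G hG x (fun _ => 1)
      simp only [mul_one] at this
      exact this
    · exact mul_le_of_le_one_right (lazyWalk_nonneg G x z) (ih z)

theorem stepProb_mul_le {V : Type u} (G : SimpleGraph V) (hG : ∀ x, (G.neighborSet x).Finite)
    (s t : ℕ) (x y z : V) : stepProb G s x y * stepProb G t y z ≤ stepProb G (s + t) x z := by
  induction s generalizing x with
  | zero =>
    by_cases h : x = y
    · simp [stepProb, h]
    · simpa [stepProb, h] using stepProb_nonneg G t x z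
  | succ s ih =>
    rw [show s + 1 + t = (s + t) + 1 by ring]
    simp only [stepProb]
    rw [finsum_mul]
    refine finsum_le_finsum' ?_ (support_finite G hG x _) fun w => ?_
    · simp only [mul_assoc]
      exact support_finite G hG x _
    · rw [mul_assoc]
      exact mul_le_mul_of_nonneg_left (ih w) (lazyWalk_nonneg G x w)

theorem stepProb_self_pos {V : Type u} (G : SimpleGraph V)
    (hG : ∀ x, (G.neighborSet x).Finite) (t : ℕ) (x : V) : 0 < stepProb G t x x := by
  induction t with
  | zero => simp [stepProb]
  | succ t ih =>
    have h1 : 0 < lazyWalk G x x := by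
      simp only [lazyWalk, Matrix.of_apply, if_true]
      split_ifs <;> norm_num
    refine (mul_pos h1 ih).trans_le ?_
    exact single_le_finsum x (support_finite G hG x fun z => stepProb G t z x)
      fun z => mul_nonneg (lazyWalk_nonneg G x z) (stepProb_nonneg G t z x)

theorem tendsto_spectralRadius (A : RootedGraph.{u}) :
    Tendsto (fun t : ℕ => (A.returnProb t) ^ (1 / (t : ℝ))) atTop (𝓝 A.spectralRadius) := by
  have hpos : ∀ t, 0 < A.returnProb t := fun t => stepProb_self_pos A.G A.locallyFinite t A.root
  have hsub : Subadditive fun t => -Real.log (A.returnProb t) := by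
    intro s t
    have := Real.log_le_log (mul_pos (hpos s) (hpos t))
      (stepProb_mul_le A.G A.locallyFinite s t A.root A.root A.root)
    rw [Real.log_mul (hpos s).ne' (hpos t).ne'] at this
    change _ ≤ Real.log (A.returnProb (s + t)) at this
    linarith
  have hbdd : BddBelow (Set.range fun t : ℕ => -Real.log (A.returnProb t) / t) := by
    refine ⟨0, ?_⟩
    rintro _ ⟨t, rfl⟩
    have := Real.log_nonpos (hpos t).le (stepProb_le_one A.G A.locallyFinite t A.root A.root)
    exact div_nonneg (by linarith) (Nat.cast_nonneg t)
  refine tendsto_nhds_limUnder ⟨Real.exp (-hsub.lim), ?_⟩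
  refine ((hsub.tendsto_lim hbdd).neg.rexp).congr fun t => ?_
  rw [Real.rpow_def_of_pos (hpos t)]
  congr 1
  ring

end RootedGraph

/-! ### The space of rooted graphs with the local topology -/

/-- The space of connected locally finite rooted graphs up to isomorphism. -/
def GraphSpace : Type (u + 1) := Quotient RootedGraph.setoid.{u}

namespace GraphSpace

/-- The isomorphism class of a rooted graph. -/
def mk (A : RootedGraph.{u}) : GraphSpace.{u} := Quotient.mk RootedGraph.setoid A

/-- The distance is the local distance. -/
noncomputable instance : PseudoMetricSpace GraphSpace.{u} where
  dist := Quotient.lift₂ RootedGraph.localDist fun A B A' B' hA hB => by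
    unfold RootedGraph.localDist
    rw [RootedGraph.agreeRadius_congr hA hB]
  dist_self := by
    rintro ⟨A⟩
    change RootedGraph.localDist A A = 0
    simp [RootedGraph.localDist, RootedGraph.agreeRadius_self]
  dist_comm := by
    rintro ⟨A⟩ ⟨B⟩
    change RootedGraph.localDist A B = RootedGraph.localDist B A
    rw [RootedGraph.localDist, RootedGraph.localDist, RootedGraph.agreeRadius_comm]
  dist_triangle := by
    rintro ⟨A⟩ ⟨B⟩ ⟨C⟩
    exact RootedGraph.localDist_triangle A B C

noncomputable instance : MeasurableSpace GraphSpace.{u} := borel _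

instance : BorelSpace GraphSpace.{u} := ⟨rfl⟩

/-- The spectral radius of an isomorphism class of rooted graphs. -/
noncomputable def spectralRadius : GraphSpace.{u} → ℝ :=
  Quotient.lift RootedGraph.spectralRadius fun A B h => by
    unfold RootedGraph.spectralRadius
    simp only [RootedGraph.Iso.returnProb_eq h]

end GraphSpace

/-! ### Local profiles of finite graphs -/

/-- The connected component of `x` in a finite graph, rooted at `x`. -/
def componentAt {V : Type u} [Finite V] (G : SimpleGraph V) (x : V) : RootedGraph.{u} where
  V := G.connectedComponentMk x
  G := (G.connectedComponentMk x).toSimpleGraph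
  root := ⟨x, SimpleGraph.ConnectedComponent.connectedComponentMk_mem⟩
  connected := (G.connectedComponentMk x).connected_toSimpleGraph
  locallyFinite := fun _ => Set.toFinite _

/-- The local profile of a finite graph `G`: the empirical distribution
`|V|⁻¹ ∑ₓ δ_(G, x)` of its rootings. -/
noncomputable def localProfile {V : Type u} [Fintype V] [Nonempty V] (G : SimpleGraph V) :
    ProbabilityMeasure GraphSpace.{u} :=
  ⟨(Fintype.card V : ENNReal)⁻¹ •
      ∑ x : V, Measure.dirac (GraphSpace.mk (componentAt G x)),
    ⟨by
      simp [ENNReal.inv_mul_cancel, Fintype.card_ne_zero]⟩⟩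

/-! ### Locality of the transition probabilities -/

/-! The moments of the eigenvalues can be read off the local profile. A return probability at time
`t` depends only on the ball of radius `t`, so it is a bounded continuous function on `GraphSpace`.
Its mean under `localProfile G` is the normalised trace of `lazyWalk G ^ t`, that is, the average of
the `t`-th powers of the eigenvalues. Laziness puts the eigenvalues in `[0, 1]`, so for `r ≥ 0` this
average is at most the proportion of eigenvalues above `r` plus `r ^ t`
(`integral_returnProb_localProfile_le`).

In the limit, spectral radius `1` forbids exponential decay: dominated convergence and Jensen give
one fixed `t` at which the mean return probability under the limit exceeds `r ^ t`
(`GraphSpace.exists_pow_lt_integral_returnProb`). Weak convergence carries this gap to all large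
`n`, and it bounds the proportion from below. -/

/-- A row of the matrix sees only the degree and the neighbours of its vertex. The hypothesis
excludes boundary vertices of `s`, whose degree would drop. -/
theorem lazyWalk_induce {V : Type u} (G : SimpleGraph V) (s : Set V) (x y : s)
    (h : G.neighborSet x ⊆ s) : lazyWalk (G.induce s) x y = lazyWalk G x y := by
  have himg : G.neighborSet x = Subtype.val '' (G.induce s).neighborSet x := by
    ext z
    constructor
    · exact fun hz => ⟨⟨z, h hz⟩, hz, rfl⟩
    · rintro ⟨z, hz, rfl⟩
      exact hz
  have hne : ((G.induce s).neighborSet x).Nonempty ↔ (G.neighborSet x).Nonempty := by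
    rw [himg, Set.image_nonempty]
  have hcard : ((G.induce s).neighborSet x).ncard = (G.neighborSet x).ncard := by
    rw [himg, Set.ncard_image_of_injective _ Subtype.val_injective]
  simp only [lazyWalk, Matrix.of_apply, hcard]
  by_cases hxy : x = y
  · rw [if_pos hxy, if_pos (congrArg Subtype.val hxy)]
    by_cases hn : (G.neighborSet x).Nonempty
    · rw [if_pos hn, if_pos (hne.2 hn)]
    · rw [if_neg hn, if_neg (mt hne.1 hn)]
  · rw [if_neg hxy, if_neg (mt Subtype.ext hxy)]
    rfl

/-- If `s` contains all vertices reachable from `x` in at most `t` steps, then the `t`-step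
transition probabilities from `x` can be computed inside `s`. -/
theorem stepProb_induce {V : Type u} (G : SimpleGraph V) (s : Set V) (t : ℕ) (x y : s)
    (h : ∀ z (p : G.Walk x z), p.length ≤ t → z ∈ s) :
    stepProb (G.induce s) t x y = stepProb G t x y := by
  induction t generalizing x with
  | zero =>
    simp only [stepProb]
    by_cases hxy : x = y
    · rw [if_pos hxy, if_pos (congrArg Subtype.val hxy)]
    · rw [if_neg hxy, if_neg (mt Subtype.ext hxy)]
  | succ t ih =>
    have hx : G.neighborSet x ⊆ s := fun z hz =>
      h z (SimpleGraph.Adj.toWalk hz) (Nat.succ_le_succ (Nat.zero_le t))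
    simp only [stepProb]
    have hsupp : ∀ z, z ∉ s → lazyWalk G x z * stepProb G t z y = 0 := fun z hz => by
      have h1 : x.1 ≠ z := fun he => hz (he ▸ x.2)
      have h2 : ¬ G.Adj x z := fun ha => hz (hx ha)
      simp [lazyWalk, h1, h2]
    have hset : ∑ᶠ z, lazyWalk G x z * stepProb G t z y
        = ∑ᶠ z : s, lazyWalk G x z * stepProb G t z y := by
      rw [finsum_set_coe_eq_finsum_mem (f := fun z => lazyWalk G x z * stepProb G t z y) s]
      refine finsum_congr fun z => ?_
      by_cases hz : z ∈ s
      · simp [hz]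
      · simp [hz, hsupp z hz]
    rw [hset]
    refine finsum_congr fun z => ?_
    rw [lazyWalk_induce G s x z hx]
    -- The hypothesis at time `t` is inherited by `x` itself (shorter walks) and by each neighbour
    -- (prepend an edge); every other `z` has weight zero.
    by_cases hxz : x = z
    · subst hxz
      rw [ih x fun w p hp => h w p (by omega)]
    by_cases ha : G.Adj x z
    · rw [ih z fun w p hp => h w (SimpleGraph.Walk.cons ha p) (by simpa using hp)]
    · have hxz' : x.1 ≠ z.1 := fun he => hxz (Subtype.ext he)
      simp [lazyWalk, hxz', ha]

namespace RootedGraph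

theorem returnProb_eq_stepProb_ballGraph (A : RootedGraph.{u}) (t : ℕ) :
    A.returnProb t = stepProb (A.ballGraph t) t (A.ballRoot t) (A.ballRoot t) :=
  (stepProb_induce A.G (A.ballSet t) t (A.ballRoot t) (A.ballRoot t) fun _ p hp =>
    (SimpleGraph.dist_le p).trans hp).symm

theorem BallIso.returnProb_eq {A B : RootedGraph.{u}} {t : ℕ} (h : BallIso A B t) :
    A.returnProb t = B.returnProb t := by
  obtain ⟨f, hf⟩ := h
  rw [returnProb_eq_stepProb_ballGraph, returnProb_eq_stepProb_ballGraph, ← hf, stepProb_iso]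

theorem returnProb_eq_of_localDist_lt {A B : RootedGraph.{u}} {t : ℕ}
    (h : localDist A B < 1 / (1 + t)) : A.returnProb t = B.returnProb t := by
  have hr : (t : ℕ∞) ≤ agreeRadius A B := by
    by_contra hlt
    have hle : (agreeRadius A B : ENNReal) ≤ t := by
      have := ENat.toENNReal_le.2 (not_le.1 hlt).le
      simpa using this
    have h1 : ((1 + (t : ENNReal))⁻¹).toReal ≤ localDist A B := by
      refine ENNReal.toReal_mono (by simp) ?_
      gcongr
    rw [ENNReal.toReal_inv, ENNReal.toReal_add (by simp) (by simp)] at h1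
    simp only [ENNReal.toReal_one, ENNReal.toReal_natCast] at h1
    rw [one_div] at h
    exact absurd h (not_lt.2 h1)
  -- For `t = 0` the bound on the radius carries no isomorphism, but both walks are at their roots
  -- at time `0`.
  rcases (le_agreeRadius_iff A B t).1 hr with rfl | hb
  · simp [returnProb, stepProb]
  · exact hb.returnProb_eq

end RootedGraph

/-! ### Return probabilities as continuous observables. -/

namespace GraphSpace

/-- The return probability at time `t` of an isomorphism class of rooted graphs. -/
noncomputable def returnProb (t : ℕ) : GraphSpace.{u} → ℝ :=
  Quotient.lift (fun A => A.returnProb t) fun _ _ h => RootedGraph.Iso.returnProb_eq h t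

theorem returnProb_pos (t : ℕ) (g : GraphSpace.{u}) : 0 < g.returnProb t := by
  obtain ⟨A⟩ := g
  exact RootedGraph.stepProb_self_pos A.G A.locallyFinite t A.root

theorem returnProb_le_one (t : ℕ) (g : GraphSpace.{u}) : g.returnProb t ≤ 1 := by
  obtain ⟨A⟩ := g
  exact RootedGraph.stepProb_le_one A.G A.locallyFinite t A.root A.root

theorem tendsto_spectralRadius (g : GraphSpace.{u}) :
    Tendsto (fun t : ℕ => (g.returnProb t) ^ (1 / (t : ℝ))) atTop (𝓝 g.spectralRadius) := by
  obtain ⟨A⟩ := g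
  exact A.tendsto_spectralRadius

/-- By locality the function is constant on every open ball of radius `1 / (1 + t)`, so this one
radius serves every `ε`. -/
theorem continuous_returnProb (t : ℕ) : Continuous (returnProb.{u} t) := by
  refine Metric.continuous_iff.2 fun g ε hε => ⟨1 / (1 + t), by positivity, fun g' hg => ?_⟩
  obtain ⟨A⟩ := g
  obtain ⟨B⟩ := g'
  have h : RootedGraph.returnProb B t = RootedGraph.returnProb A t :=
    RootedGraph.returnProb_eq_of_localDist_lt hg
  change dist (RootedGraph.returnProb B t) (RootedGraph.returnProb A t) < ε
  rwa [h, dist_self]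

theorem integrable_returnProb (t : ℕ) (μ : Measure GraphSpace.{u}) [IsFiniteMeasure μ] :
    Integrable (returnProb t) μ :=
  Integrable.of_bound (continuous_returnProb t).aestronglyMeasurable 1
    (ae_of_all _ fun g => by
      rw [Real.norm_of_nonneg (returnProb_pos t g).le]
      exact returnProb_le_one t g)

/-- If the spectral radius is almost surely `1`, the mean return probability does not decay
exponentially. -/
theorem exists_pow_lt_integral_returnProb (μ : Measure GraphSpace.{u}) [IsProbabilityMeasure μ]
    (h : ∀ᵐ g ∂μ, g.spectralRadius = 1) {r : ℝ} (hr0 : 0 ≤ r) (hr : r < 1) :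
    ∃ t, r ^ t < ∫ g, returnProb t g ∂μ := by
  have hnorm : ∀ (t : ℕ) (g : GraphSpace.{u}), ‖returnProb t g ^ (1 / (t : ℝ))‖ ≤ 1 := fun t g => by
    rw [Real.norm_of_nonneg (Real.rpow_nonneg (returnProb_pos t g).le _)]
    exact Real.rpow_le_one (returnProb_pos t g).le (returnProb_le_one t g) (by positivity)
  have hmeas : ∀ t : ℕ,
      AEStronglyMeasurable (fun g : GraphSpace.{u} => returnProb t g ^ (1 / (t : ℝ))) μ := fun t =>
    ((continuous_returnProb t).rpow_const fun g =>
      Or.inl (returnProb_pos t g).ne').aestronglyMeasurable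
  have hlim : Tendsto (fun t : ℕ => ∫ g, returnProb t g ^ (1 / (t : ℝ)) ∂μ) atTop (𝓝 1) := by
    have := tendsto_integral_of_dominated_convergence (μ := μ) (f := fun _ => (1 : ℝ))
      (fun _ => 1) hmeas (integrable_const 1) (fun t => ae_of_all _ (hnorm t))
      (h.mono fun g hg => hg ▸ g.tendsto_spectralRadius)
    simpa using this
  -- `t ≥ 1` is needed because at `t = 0` the exponent `1 / t` is `0` and taking the `t`-th power
  -- does not undo it.
  obtain ⟨t, ht, ht0⟩ := ((hlim.eventually_const_lt hr).and (eventually_ge_atTop 1)).exists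
  have hpow : ∀ g : GraphSpace.{u}, (returnProb t g ^ (1 / (t : ℝ))) ^ t = returnProb t g :=
    fun g => by
      rw [one_div]
      exact Real.rpow_inv_natCast_pow (returnProb_pos t g).le (by omega)
  refine ⟨t, (pow_lt_pow_left₀ ht hr0 (by omega)).trans_le ?_⟩
  -- Jensen for `x ^ t` on `[0, ∞)`: the `t`-th power of the mean of the `t`-th roots is at most the
  -- mean return probability.
  have := (convexOn_pow t).map_integral_le (μ := μ)
    (f := fun g : GraphSpace.{u} => returnProb t g ^ (1 / (t : ℝ)))
    (continuous_pow t).continuousOn isClosed_Ici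
    (ae_of_all _ fun g => Real.rpow_nonneg (returnProb_pos t g).le _)
    (Integrable.of_bound (hmeas t) 1 (ae_of_all _ (hnorm t)))
    (by simpa only [Function.comp_def, hpow] using integrable_returnProb t μ)
  simpa only [hpow] using this

end GraphSpace

/-! ### Return probabilities and eigenvalues of finite graphs -/

open Classical in
theorem stepProb_eq_pow {V : Type u} [Fintype V] (G : SimpleGraph V) (t : ℕ) (x y : V) :
    stepProb G t x y = (lazyWalk G ^ t) x y := by
  induction t generalizing x with
  | zero => simp [stepProb, Matrix.one_apply]
  | succ t ih =>
    rw [pow_succ', Matrix.mul_apply]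
    simp only [stepProb, finsum_eq_sum_of_fintype, ih]

/-- A component contains every walk that starts in it, whatever its length, so `stepProb_induce`
applies at all times. -/
theorem returnProb_componentAt {V : Type u} [Finite V] (G : SimpleGraph V) (t : ℕ) (x : V) :
    (componentAt G x).returnProb t = stepProb G t x x :=
  stepProb_induce G (G.connectedComponentMk x).supp t ⟨x, rfl⟩ ⟨x, rfl⟩ fun _ p _ =>
    SimpleGraph.ConnectedComponent.sound p.reachable.symm

open Classical in
theorem integral_returnProb_localProfile {V : Type u} [Fintype V] [Nonempty V]
    (G : SimpleGraph V) (t : ℕ) :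
    ∫ g, GraphSpace.returnProb t g ∂(localProfile G : Measure GraphSpace.{u})
      = (lazyWalk G ^ t).trace / Fintype.card V := by
  have hsm := (GraphSpace.continuous_returnProb.{u} t).stronglyMeasurable
  change ∫ g, GraphSpace.returnProb t g ∂((Fintype.card V : ENNReal)⁻¹ •
      ∑ x : V, Measure.dirac (GraphSpace.mk (componentAt G x))) = _
  rw [integral_smul_measure, integral_finsetSum_measure
    fun x _ => GraphSpace.integrable_returnProb t _]
  simp only [integral_dirac' _ _ hsm]
  have hx : ∀ x, GraphSpace.returnProb t (GraphSpace.mk (componentAt G x))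
      = (lazyWalk G ^ t) x x := fun x =>
    (returnProb_componentAt G t x).trans (stepProb_eq_pow G t x x)
  simp only [hx, Matrix.trace, Matrix.diag_apply, ENNReal.toReal_inv, ENNReal.toReal_natCast,
    smul_eq_mul]
  rw [div_eq_inv_mul]

/-! ### Symmetrisation, traces and location of the spectrum. -/

theorem Matrix.IsHermitian.trace_pow_eq_sum_eigenvalues {n : Type*} [Fintype n] [DecidableEq n]
    {A : Matrix n n ℝ} (hA : A.IsHermitian) (t : ℕ) :
    (A ^ t).trace = ∑ i, hA.eigenvalues i ^ t := by
  conv_lhs => rw [hA.spectral_theorem, ← map_pow, Unitary.conjStarAlgAut_apply,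
    Matrix.trace_mul_comm, ← mul_assoc]
  simp [Matrix.diagonal_pow, Matrix.trace_diagonal]

open Classical in
/-- Conjugation by the square roots of the degrees makes the transition matrix symmetric. -/
theorem exists_units_conj_lazyWalk_isHermitian {V : Type u} [Fintype V] (G : SimpleGraph V) :
    ∃ U : (Matrix V V ℝ)ˣ, (U.val * lazyWalk G * U⁻¹.val).IsHermitian := by
  -- The value `1` at isolated vertices, in place of `√0`, keeps the diagonal matrix invertible;
  -- such vertices have no off-diagonal entries to symmetrise.
  let w : V → ℝ := fun x =>
    if (G.neighborSet x).Nonempty then √((G.neighborSet x).ncard : ℝ) else 1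
  have hw : ∀ x, w x ≠ 0 := fun x => by
    simp only [w]
    split_ifs with h
    · have := (Set.ncard_pos (Set.toFinite _)).2 h
      positivity
    · exact one_ne_zero
  refine ⟨⟨Matrix.diagonal w, Matrix.diagonal fun x => (w x)⁻¹, by simp [hw], by simp [hw]⟩, ?_⟩
  ext x y
  simp only [Units.inv_mk, Matrix.conjTranspose_apply, Matrix.mul_diagonal,
    Matrix.diagonal_mul, star_trivial]
  by_cases hxy : x = y
  · rw [hxy]
  by_cases ha : G.Adj x y
  · have hx : (G.neighborSet x).Nonempty := ⟨y, ha⟩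
    have hy : (G.neighborSet y).Nonempty := ⟨x, ha.symm⟩
    -- With degrees written as `w x * w x`, the conjugated entry becomes `1 / (2 * w x * w y)`,
    -- symmetric in `x` and `y`.
    have hwx : ((G.neighborSet x).ncard : ℝ) = w x * w x := by
      simp only [w, if_pos hx, Real.mul_self_sqrt (Nat.cast_nonneg _)]
    have hwy : ((G.neighborSet y).ncard : ℝ) = w y * w y := by
      simp only [w, if_pos hy, Real.mul_self_sqrt (Nat.cast_nonneg _)]
    simp only [lazyWalk, Matrix.of_apply, hxy, Ne.symm hxy, ha, ha.symm, if_true, if_false,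
      hwx, hwy]
    have := hw x
    have := hw y
    field_simp
  · have ha' : ¬ G.Adj y x := fun h => ha h.symm
    simp [lazyWalk, hxy, Ne.symm hxy, ha, ha']

-- Gershgorin: `l` lies in a disc centred at some diagonal entry `p ≥ 1/2`, of radius `1 - p`
-- because rows sum to `1`. Hence `0 ≤ 2 * p - 1 ≤ l ≤ 1`; the lower bound is where laziness enters.
open Classical in
theorem mem_Icc_of_mem_roots_charpoly_lazyWalk {V : Type u} [Fintype V] (G : SimpleGraph V)
    {l : ℝ} (hl : l ∈ (lazyWalk G).charpoly.roots) : l ∈ Set.Icc (0 : ℝ) 1 := by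
  have hspec : l ∈ spectrum ℝ (lazyWalk G) :=
    Matrix.mem_spectrum_of_isRoot_charpoly (Polynomial.isRoot_of_mem_roots hl)
  rw [← Matrix.spectrum_toLin', ← Module.End.hasEigenvalue_iff_mem_spectrum] at hspec
  obtain ⟨x, hx⟩ := eigenvalue_mem_ball hspec
  have hsum : lazyWalk G x x + ∑ y ∈ Finset.univ.erase x, ‖lazyWalk G x y‖ = 1 := by
    rw [← RootedGraph.lazyWalk_sum G x (Set.toFinite _), finsum_eq_sum_of_fintype,
      ← Finset.add_sum_erase _ _ (Finset.mem_univ x)]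
    congr 1
    exact Finset.sum_congr rfl fun y _ => Real.norm_of_nonneg (RootedGraph.lazyWalk_nonneg G x y)
  have hhalf : 1 / 2 ≤ lazyWalk G x x := by
    simp only [lazyWalk, Matrix.of_apply, if_true]
    split_ifs <;> norm_num
  rw [Metric.mem_closedBall, Real.dist_eq, abs_le] at hx
  constructor <;> linarith [hx.1, hx.2]

open Classical in
theorem card_roots_charpoly_lazyWalk_le {V : Type u} [Fintype V] (G : SimpleGraph V) :
    (lazyWalk G).charpoly.roots.card ≤ Fintype.card V :=
  (Polynomial.card_roots' _).trans_eq (lazyWalk G).charpoly_natDegree_eq_dim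

-- Trace and characteristic polynomial are both invariant under conjugation, so the identity reduces
-- to the symmetric conjugate, whose characteristic roots are its real eigenvalues.
open Classical in
theorem trace_lazyWalk_pow {V : Type u} [Fintype V] (G : SimpleGraph V) (t : ℕ) :
    (lazyWalk G ^ t).trace = ((lazyWalk G).charpoly.roots.map (· ^ t)).sum := by
  obtain ⟨U, hU⟩ := exists_units_conj_lazyWalk_isHermitian G
  have h1 : (lazyWalk G ^ t).trace = ((U.val * lazyWalk G * U⁻¹.val) ^ t).trace := by
    rw [Units.conj_pow, Matrix.trace_mul_comm, ← mul_assoc, Units.inv_mul, one_mul]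
  have h2 : (lazyWalk G).charpoly.roots = Finset.univ.val.map hU.eigenvalues := by
    have h3 : (U.val * lazyWalk G * U⁻¹.val).charpoly = (lazyWalk G).charpoly := by
      rw [Matrix.coe_units_inv, Matrix.charpoly_units_conj]
    rw [← h3]
    exact hU.roots_charpoly_eq_eigenvalues
  rw [h1, hU.trace_pow_eq_sum_eigenvalues, h2, Multiset.map_map]
  rfl

/-! ### Counting eigenvalues above a threshold, and the limit. -/

/-- Elements above `r` contribute at most `1` each, the others at most `r ^ t`; the number of the
latter is crudely bounded by `s.card`. -/
theorem Multiset.sum_map_pow_le {s : Multiset ℝ} (hs : ∀ l ∈ s, l ∈ Set.Icc (0 : ℝ) 1) {r : ℝ}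
    (hr : 0 ≤ r) (t : ℕ) :
    (s.map (· ^ t)).sum ≤ (s.filter fun l => r < l).card + s.card * r ^ t := by
  induction s using Multiset.induction_on with
  | empty => simp
  | cons a s ih =>
    have ih' := ih fun l hl => hs l (Multiset.mem_cons_of_mem hl)
    obtain ⟨ha0, ha1⟩ := hs a (Multiset.mem_cons_self a s)
    have hrt : 0 ≤ r ^ t := pow_nonneg hr t
    rw [Multiset.map_cons, Multiset.sum_cons, Multiset.card_cons]
    by_cases h : r < a
    · rw [Multiset.filter_cons_of_pos _ h, Multiset.card_cons]
      have := pow_le_one₀ (n := t) ha0 ha1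
      push_cast
      linarith
    · rw [Multiset.filter_cons_of_neg _ h]
      have := pow_le_pow_left₀ ha0 (not_lt.1 h) t
      push_cast
      linarith

open Classical in
theorem trace_lazyWalk_pow_le {V : Type u} [Fintype V] (G : SimpleGraph V) {r : ℝ}
    (hr : 0 ≤ r) (t : ℕ) :
    (lazyWalk G ^ t).trace ≤ numEigenvaluesGT G r + Fintype.card V * r ^ t := by
  rw [trace_lazyWalk_pow]
  refine (Multiset.sum_map_pow_le
    (fun l hl => mem_Icc_of_mem_roots_charpoly_lazyWalk G hl) hr t).trans ?_
  refine add_le_add ?_ (mul_le_mul_of_nonneg_right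
    (Nat.cast_le.2 (card_roots_charpoly_lazyWalk_le G)) (pow_nonneg hr t))
  rw [numEigenvaluesGT]

theorem numEigenvaluesGT_le_card {V : Type u} [Fintype V] (G : SimpleGraph V) (r : ℝ) :
    numEigenvaluesGT G r ≤ Fintype.card V :=
  (Multiset.card_le_card (Multiset.filter_le _ _)).trans (card_roots_charpoly_lazyWalk_le G)

theorem numEigenvaluesGT_anti {V : Type u} [Fintype V] (G : SimpleGraph V) {r s : ℝ}
    (h : r ≤ s) : numEigenvaluesGT G s ≤ numEigenvaluesGT G r :=
  Multiset.card_le_card (Multiset.monotone_filter_right _ fun _ hl => h.trans_lt hl)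

theorem integral_returnProb_localProfile_le {V : Type u} [Fintype V] [Nonempty V]
    (G : SimpleGraph V) {r : ℝ} (hr : 0 ≤ r) (t : ℕ) :
    ∫ g, GraphSpace.returnProb t g ∂(localProfile G : Measure GraphSpace.{u})
      ≤ (numEigenvaluesGT G r : ℝ) / Fintype.card V + r ^ t := by
  classical
  have hcard : (0 : ℝ) < Fintype.card V := Nat.cast_pos.2 Fintype.card_pos
  rw [integral_returnProb_localProfile, div_le_iff₀ hcard, add_mul,
    div_mul_cancel₀ _ hcard.ne', mul_comm (r ^ t)]
  exact trace_lazyWalk_pow_le G hr t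

theorem theorem3p2 {V : ℕ → Type u} [∀ n, Fintype (V n)] [∀ n, Nonempty (V n)]
    (G : ∀ n, SimpleGraph (V n)) (L : ProbabilityMeasure GraphSpace.{u})
    (hlim : Tendsto (fun n => localProfile (G n)) atTop (𝓝 L))
    (hrad : ∀ᵐ g ∂(L : Measure GraphSpace.{u}), g.spectralRadius = 1)
    (ρ : ℝ) (hρ : ρ < 1) :
    0 < liminf (fun n => (numEigenvaluesGT (G n) ρ : ℝ) / (Fintype.card (V n) : ℝ)) atTop := by
  -- The power bounds need a nonnegative threshold; raising `ρ` to `r` can only decrease the count.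
  set r := max ρ 0
  have hr0 : 0 ≤ r := le_max_right _ _
  obtain ⟨t, ht⟩ := GraphSpace.exists_pow_lt_integral_returnProb (L : Measure GraphSpace.{u}) hrad
    hr0 (max_lt hρ one_pos)
  -- The liminf will be at least `c - r ^ t`; the room between `c` and the limiting mean absorbs the
  -- convergence error.
  obtain ⟨c, hc, hcL⟩ := exists_between ht
  let φ : BoundedContinuousFunction GraphSpace.{u} ℝ :=
    BoundedContinuousFunction.ofNormedAddCommGroup (GraphSpace.returnProb t)
      (GraphSpace.continuous_returnProb t) 1 fun g => by
        rw [Real.norm_of_nonneg (GraphSpace.returnProb_pos t g).le]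
        exact GraphSpace.returnProb_le_one t g
  have hev : ∀ᶠ n in atTop,
      c < ∫ g, GraphSpace.returnProb t g ∂(localProfile (G n) : Measure GraphSpace.{u}) :=
    (ProbabilityMeasure.tendsto_iff_forall_integral_tendsto.1 hlim φ).eventually_const_lt hcL
  refine (sub_pos.2 hc).trans_le (le_liminf_of_le ?_ (hev.mono fun n hn => ?_))
  -- The real-valued liminf is meaningful here because the proportions are at most `1`.
  · refine (isBoundedUnder_of ⟨1, fun n => ?_⟩).isCoboundedUnder_ge
    exact div_le_one_of_le₀ (Nat.cast_le.2 (numEigenvaluesGT_le_card (G n) ρ)) (Nat.cast_nonneg _)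
  · have h1 := integral_returnProb_localProfile_le (G n) hr0 t
    have h2 : (numEigenvaluesGT (G n) r : ℝ) / Fintype.card (V n)
        ≤ (numEigenvaluesGT (G n) ρ : ℝ) / Fintype.card (V n) := by
      gcongr
      exact numEigenvaluesGT_anti (G n) (le_max_left _ _)
    linarith
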